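/- Let $p$ be a prime, let $c\in(0,1)$, and let $Y$ be a real random variable with $\mathbb{E}[|Y|^\alpha]<\infty$ for some $\alpha>0$. Let $\{Y^k_n\}_{k\ge 1,\,0\le n\le p^k-1}$ be a triangular array of i.i.d. random variables with the same law as $Y$, and extend it periodically to all $n\ge 0$ by setting $Y^k_\ell=Y^k_n$ whenever $\ell\equiv n \pmod{p^k}$. Then, almost surely, for every $n\ge 0$ the series $$X_n:=\sum_{k=1}^\infty c^k\,(Y^k_n-Y^k_0)$$ converges absolutely, and the process $\{X_n\}_{n\ge 0}$ has bounded sample paths, that is, $\sup_{n\ge 0}|X_n|<\infty$ almost surely, if and only if $$\mathbb{E}\big[|Y|^{-\frac{\log p}{\log c}}\big]<\infty .$$ -/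

import Mathlib

open MeasureTheory ProbabilityTheory

namespace PadicSssi

/-- `{Y^k_n : k ≥ 1, 0 ≤ n ≤ p^k - 1}` (the function `η k n`, of which only these entries matter)
is a triangular array of i.i.d. real random variables on `(Ω, P)` with the same law as `Y`. -/
structure IsIIDTriangularArray {Ω Ω' : Type*} [MeasurableSpace Ω] [MeasurableSpace Ω']
    (P : Measure Ω) (P' : Measure Ω') (p : ℕ) (η : ℕ → ℕ → Ω → ℝ) (Y : Ω' → ℝ) : Prop where
  indep : iIndepFun (fun i : {i : ℕ × ℕ // 1 ≤ i.1 ∧ i.2 < p ^ i.1} => η i.1.1 i.1.2) P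
  identDistrib : ∀ k n : ℕ, 1 ≤ k → n < p ^ k → IdentDistrib (η k n) Y P P'

/-- The periodic extension of the array to all `n ≥ 0`: the row `k` has period `p ^ k`. -/
def periodicExt {Ω : Type*} (p : ℕ) (η : ℕ → ℕ → Ω → ℝ) (k n : ℕ) (ω : Ω) : ℝ :=
  η k (n % p ^ k) ω

/-- The summand `c^k (Y^k_n - Y^k_0)`. -/
def term {Ω : Type*} (p : ℕ) (c : ℝ) (η : ℕ → ℕ → Ω → ℝ) (n k : ℕ) (ω : Ω) : ℝ :=
  c ^ k * (periodicExt p η k n ω - periodicExt p η k 0 ω)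

/-- `X_n = ∑_{k ≥ 1} c^k (Y^k_n - Y^k_0)`; the sum over `k ≥ 1` is shifted to start at `0`. -/
noncomputable def process {Ω : Type*} (p : ℕ) (c : ℝ) (η : ℕ → ℕ → Ω → ℝ) (n : ℕ) (ω : Ω) : ℝ :=
  ∑' k : ℕ, term p c η n (k + 1) ω

/-- A process indexed by `n ≥ 0` has bounded sample paths: `sup_n |X_n| < ∞` almost surely. -/
def HasBoundedSamplePaths {Ω : Type*} [MeasurableSpace Ω] (P : Measure Ω) (X : ℕ → Ω → ℝ) : Prop :=
  ∀ᵐ ω ∂P, BddAbove (Set.range fun n : ℕ => |X n ω|)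

end PadicSssi

namespace PadicSssi

/-! ### Elementary inequalities for real powers -/

/-! With `q = -log p / log c` one has `p * c ^ q = 1`: the branching of the `p`-adic tree exactly
balances the decay of the weights in the `q`-th moment.

Sufficiency. Replacing `|Y|`, `c`, `q` by `|Y| ^ r`, `c ^ r`, `q / r` with `r = min q 1` reduces to
nonnegative entries and `q ≥ 1`. The maximum `W_K` over branches of depth `K` increases in `K` and
satisfies `W_{K+1} = c * max_i (z_i + W_K^{(i)})`, where each subtree maximum is distributed as
`W_K` and independent of `z_i`. Since the balance is critical, the plain `q`-th moment gives no
uniform bound, so the recursion is tested against `(x - a)_+ ^ q` with `c * (a + s) = a`. The shift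
by `s` gains `q * s * E[(W_K - a - s)_+ ^ (q - 1)]`, while the new entries cost at most a constant
times `E[(W_K - a - s)_+ ^ (q - 1)] * E[Y] + E[Y ^ q]` (`lintegral_branchMax_drift_le`). For large
`s` the gain wins, which makes the `W_K` tight (`exists_measure_branchMax_le`) and, by monotonicity,
almost surely bounded.

Necessity. If `E[|Y| ^ q] = ∞`, Borel–Cantelli over the nodes `n` with `p ^ l ≤ n < p ^ (l + 1)`,
read at level `l + 1`, produces arbitrarily large weighted entries. The paths at `n` and `n % p ^ l`
agree up to level `l`, so a large entry separates them unless the tails compensate (`abs_entry_le`).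
The relevant tails are independent of the first large entry and are small with probability at least
`1 / 2`, so boundedness fails with positive probability. -/

theorem rpow_add_mul_le_add_rpow {q x h : ℝ} (hq : 1 ≤ q) (hx : 0 ≤ x) (hh : 0 ≤ h) :
    x ^ q + q * h * x ^ (q - 1) ≤ (x + h) ^ q := by
  rcases hx.eq_or_lt with rfl | hx
  · rcases hq.eq_or_lt with rfl | hq
    · simp
    · rw [Real.zero_rpow (by linarith), Real.zero_rpow (by linarith)]
      simpa using Real.rpow_nonneg hh q
  · have hb := one_add_mul_self_le_rpow_one_add (s := h / x) (by have := div_nonneg hh hx.le; linarith) hq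
    have hxq : 0 < x ^ q := Real.rpow_pos_of_pos hx q
    have e1 : (x + h) ^ q = x ^ q * (1 + h / x) ^ q := by
      rw [← Real.mul_rpow hx.le (by positivity)]
      congr 1
      field_simp
    have e2 : x ^ (q - 1) = x ^ q / x := Real.rpow_sub_one hx.ne' q
    rw [e1, e2]
    calc x ^ q + q * h * (x ^ q / x) = x ^ q * (1 + q * (h / x)) := by ring
      _ ≤ _ := by gcongr

/-- Convexity again, with the tangent now taken at the right endpoint: Bernoulli's inequality at `-h
/ (x + h)`. -/
theorem add_rpow_le_rpow_add_mul {q x h : ℝ} (hq : 1 ≤ q) (hx : 0 ≤ x) (hh : 0 ≤ h) :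
    (x + h) ^ q ≤ x ^ q + q * h * (x + h) ^ (q - 1) := by
  rcases (add_nonneg hx hh).eq_or_lt with h0 | h0
  · have hx0 : x = 0 := by linarith
    have hh0 : h = 0 := by linarith
    subst hx0 hh0
    simp
  · have hb := one_add_mul_self_le_rpow_one_add (s := -h / (x + h))
      (by rw [le_div_iff₀ h0]; linarith) hq
    have hxq : 0 < (x + h) ^ q := Real.rpow_pos_of_pos h0 q
    have e1 : x ^ q = (x + h) ^ q * (1 + -h / (x + h)) ^ q := by
      have : 1 + -h / (x + h) = x / (x + h) := by field_simp; ring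
      rw [this, ← Real.mul_rpow h0.le (by positivity)]
      congr 1
      field_simp
    have e2 : (x + h) ^ (q - 1) = (x + h) ^ q / (x + h) := Real.rpow_sub_one h0.ne' q
    rw [e2, e1]
    have := mul_le_mul_of_nonneg_left hb hxq.le
    have e3 : (x + h) ^ q * (1 + q * (-h / (x + h))) =
      (x + h) ^ q - q * h * ((x + h) ^ q / (x + h)) := by ring
    linarith

theorem add_rpow_le_two_rpow_mul {r x h : ℝ} (hr : 0 ≤ r) (hx : 0 ≤ x) (hh : 0 ≤ h) :
    (x + h) ^ r ≤ 2 ^ r * (x ^ r + h ^ r) := by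
  have hx' := Real.rpow_nonneg hx r
  have hh' := Real.rpow_nonneg hh r
  rcases le_total x h with hxh | hxh
  · calc (x + h) ^ r ≤ (2 * h) ^ r := by gcongr; linarith
      _ = 2 ^ r * h ^ r := Real.mul_rpow (by norm_num) hh
      _ ≤ _ := by gcongr; linarith
  · calc (x + h) ^ r ≤ (2 * x) ^ r := by gcongr; linarith
      _ = 2 ^ r * x ^ r := Real.mul_rpow (by norm_num) hx
      _ ≤ _ := by gcongr; linarith

/-- `x ^ (q - 1)` on the positive half-line, and `0` elsewhere. -/
noncomputable def posPow (q x : ℝ) : ℝ := if 0 < x then x ^ (q - 1) else 0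

theorem posPow_nonneg (q x : ℝ) : 0 ≤ posPow q x := by
  unfold posPow
  split_ifs with h
  · exact Real.rpow_nonneg h.le _
  · exact le_rfl

theorem measurable_posPow (q : ℝ) : Measurable (posPow q) :=
  Measurable.ite measurableSet_Ioi (by fun_prop) measurable_const

theorem one_le_posPow {q x : ℝ} (hq : 1 ≤ q) (hx : 1 ≤ x) : 1 ≤ posPow q x := by
  rw [posPow, if_pos (by linarith)]
  exact Real.one_le_rpow hx (by linarith)

/-- The term linear in `h` carries the factor `posPow q x`, the same quantity that the shift gains
in `rpow_add_posPow_le`; this lets the two be compared. -/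
theorem add_rpow_le_posPow {q x h : ℝ} (hq : 1 ≤ q) (hx : 0 ≤ x) (hh : 0 ≤ h) :
    (x + h) ^ q ≤ x ^ q + q * 2 ^ (q - 1) * (posPow q x * h + h ^ q) := by
  have h2 : (1 : ℝ) ≤ 2 ^ (q - 1) := Real.one_le_rpow (by norm_num) (by linarith)
  have hhq := Real.rpow_nonneg hh q
  rcases hx.eq_or_lt with rfl | hx
  · rw [posPow, if_neg (lt_irrefl _), Real.zero_rpow (by linarith)]
    have : 1 ≤ q * 2 ^ (q - 1) := by nlinarith
    simp only [zero_add, zero_mul]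
    nlinarith
  · rw [posPow, if_pos hx]
    have e : h ^ q = h * h ^ (q - 1) := by
      rcases hh.eq_or_lt with rfl | hh
      · rw [Real.zero_rpow (by linarith), zero_mul]
      · rw [← Real.rpow_one_add' hh.le (by linarith)]
        congr 1
        ring
    calc (x + h) ^ q ≤ x ^ q + q * h * (x + h) ^ (q - 1) := add_rpow_le_rpow_add_mul hq hx.le hh
      _ ≤ x ^ q + q * h * (2 ^ (q - 1) * (x ^ (q - 1) + h ^ (q - 1))) := by
        gcongr
        exact add_rpow_le_two_rpow_mul (by linarith) hx.le hh
      _ = _ := by rw [e]; ring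

theorem rpow_add_posPow_le {q w a s : ℝ} (hq : 1 ≤ q) (hs : 0 ≤ s) :
    max (w - a - s) 0 ^ q + q * s * posPow q (max (w - a - s) 0) ≤ max (w - a) 0 ^ q := by
  rcases le_or_gt (w - a - s) 0 with h | h
  -- Here `posPow` must vanish at `0`: for `q = 1` the value `0 ^ 0 = 1` would claim a gain `s`
  -- where there is none.
  · rw [max_eq_right h, posPow, if_neg (lt_irrefl _), Real.zero_rpow (by linarith)]
    simpa using Real.rpow_nonneg (le_max_right _ _) q
  · rw [max_eq_left h.le, max_eq_left (by linarith), posPow, if_pos h]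
    have := rpow_add_mul_le_add_rpow hq h.le hs
    simpa using this

/-! ### Independence of functions of disjoint families -/

theorem indepFun_of_measurable_iSup_comap {Ω ι β γ : Type*} [MeasurableSpace Ω] {P : Measure Ω}
    {κ : ι → Type*} [∀ i, MeasurableSpace (κ i)] [MeasurableSpace β] [MeasurableSpace γ]
    {f : ∀ i, Ω → κ i} (hf : iIndepFun f P) (hm : ∀ i, Measurable (f i)) {S T : Set ι}
    (hST : Disjoint S T) {g : Ω → β} {h : Ω → γ}
    (hg : Measurable[⨆ i ∈ S, MeasurableSpace.comap (f i) inferInstance] g)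
    (hh : Measurable[⨆ i ∈ T, MeasurableSpace.comap (f i) inferInstance] h) :
    IndepFun g h P := by
  rw [IndepFun_iff_Indep]
  exact indep_of_indep_of_le_left (indep_of_indep_of_le_right
    (indep_iSup_of_disjoint (fun i => (hm i).comap_le) hf.iIndep hST) hh.comap_le) hg.comap_le

theorem measurable_iSup_comap {Ω ι : Type*} {κ : ι → Type*} [∀ i, MeasurableSpace (κ i)]
    (f : ∀ i, Ω → κ i) {S : Set ι} {i : ι} (hi : i ∈ S) :
    Measurable[⨆ i ∈ S, MeasurableSpace.comap (f i) inferInstance] (f i) :=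
  (comap_measurable (f i)).mono
    (le_iSup₂_of_le (f := fun i (_ : i ∈ S) => MeasurableSpace.comap (f i) inferInstance) i hi le_rfl)
    le_rfl

/-! ### The maximum over the branches of the `p`-adic tree -/

/-- The nodes of the `p`-adic tree below the root: the residues modulo `p ^ k`, for `k ≥ 1`. -/
abbrev TreeIndex (p : ℕ) : Type := {i : ℕ × ℕ // 1 ≤ i.1 ∧ i.2 < p ^ i.1}

/-- The array extended by zero outside the tree. -/
noncomputable def extendArray (p : ℕ) (x : TreeIndex p → ℝ) (k m : ℕ) : ℝ :=
  if h : 1 ≤ k ∧ m < p ^ k then x ⟨(k, m), h⟩ else 0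

/-- The largest value of `∑ c ^ k * z k (n % p ^ k)`, `1 ≤ k ≤ K`, over all `n`. -/
noncomputable def branchMax (p : ℕ) (c : ℝ) : ℕ → (ℕ → ℕ → ℝ) → ℝ
  | 0, _ => 0
  | K + 1, z => c * ⨆ i : Fin p, (z 1 i + branchMax p c K fun k m => z (k + 1) (i + p * m))

theorem child_lt {p k m : ℕ} (i : Fin p) (hm : m < p ^ k) : (i : ℕ) + p * m < p ^ (k + 1) := by
  have h1 := i.2
  have h2 : p * (m + 1) ≤ p * p ^ k := Nat.mul_le_mul_left _ hm
  rw [pow_succ']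
  linarith

theorem measurable_extendArray (p : ℕ) : Measurable (extendArray p) := by
  refine measurable_pi_iff.2 fun k => measurable_pi_iff.2 fun m => ?_
  unfold extendArray
  split_ifs with h
  · exact measurable_pi_apply _
  · exact measurable_const

theorem measurable_branchMax (p : ℕ) (c : ℝ) (K : ℕ) : Measurable (branchMax p c K) := by
  induction K with
  | zero => exact measurable_const
  | succ K ih =>
    refine Measurable.const_mul (Measurable.iSup fun i => ?_) c
    refine Measurable.add (by fun_prop) (ih.comp ?_)
    fun_prop

theorem branchMax_congr {p : ℕ} {c : ℝ} {K : ℕ} {z z' : ℕ → ℕ → ℝ}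
    (h : ∀ k m, 1 ≤ k → m < p ^ k → z k m = z' k m) : branchMax p c K z = branchMax p c K z' := by
  induction K generalizing z z' with
  | zero => rfl
  | succ K ih =>
    unfold branchMax
    congr 2
    funext i
    rw [h 1 i le_rfl (by simp), ih fun k m _ hm => h (k + 1) (i + p * m) (by omega) (child_lt i hm)]

theorem branchMax_nonneg {p : ℕ} {c : ℝ} (hc : 0 ≤ c) (K : ℕ) {z : ℕ → ℕ → ℝ}
    (hz : ∀ k m, 0 ≤ z k m) : 0 ≤ branchMax p c K z := by
  induction K generalizing z with
  | zero => exact le_rfl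
  | succ K ih => exact mul_nonneg hc (Real.iSup_nonneg fun i => add_nonneg (hz _ _) (ih fun _ _ => hz _ _))

theorem branchMax_le_succ {p : ℕ} [NeZero p] {c : ℝ} (hc : 0 ≤ c) (K : ℕ) {z : ℕ → ℕ → ℝ}
    (hz : ∀ k m, 0 ≤ z k m) : branchMax p c K z ≤ branchMax p c (K + 1) z := by
  induction K generalizing z with
  | zero => exact branchMax_nonneg hc 1 hz
  | succ K ih =>
    rw [branchMax, branchMax]
    gcongr with i
    · exact (Set.finite_range _).bddAbove
    · exact ih fun _ _ => hz _ _

theorem sum_le_branchMax {p : ℕ} [NeZero p] {c : ℝ} (hc : 0 ≤ c) (K n : ℕ) (z : ℕ → ℕ → ℝ) :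
    ∑ k ∈ Finset.range K, c ^ (k + 1) * z (k + 1) (n % p ^ (k + 1)) ≤ branchMax p c K z := by
  induction K generalizing z n with
  | zero => simp [branchMax]
  | succ K ih =>
    rw [Finset.sum_range_succ', branchMax]
    -- The lowest base-`p` digit of `n` selects the child, and `n / p` is the index inside its
    -- subtree.
    let i : Fin p := ⟨n % p, Nat.mod_lt _ (NeZero.pos p)⟩
    have h1 := ih (n / p) fun k m => z (k + 1) (i + p * m)
    have h2 : z 1 i + branchMax p c K (fun k m => z (k + 1) (i + p * m)) ≤
        ⨆ i : Fin p, (z 1 i + branchMax p c K fun k m => z (k + 1) (i + p * m)) :=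
      le_ciSup (f := fun i : Fin p => z 1 i + branchMax p c K fun k m => z (k + 1) (i + p * m))
        (Set.finite_range _).bddAbove i
    calc _ = c * (z 1 i + ∑ k ∈ Finset.range K,
          c ^ (k + 1) * z (k + 1 + 1) (i + p * (n / p % p ^ (k + 1)))) := by
          rw [mul_add, Finset.mul_sum, add_comm]
          congr 1
          · simp [i]
          · refine Finset.sum_congr rfl fun k _ => ?_
            rw [pow_succ' p (k + 1), Nat.mod_mul]
            simp only [i]
            ring
      _ ≤ _ := by gcongr; exact le_trans (by gcongr) h2

/-- The subtree below the node `i` of the first level has the same law as the whole tree. -/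
theorem identDistrib_branchMax_child {Ω Ω' : Type*} [MeasurableSpace Ω] [MeasurableSpace Ω']
    {P : Measure Ω} [IsProbabilityMeasure P] {P' : Measure Ω'} {p : ℕ} {η : ℕ → ℕ → Ω → ℝ}
    {Y : Ω' → ℝ} (hη : IsIIDTriangularArray P P' p η Y) (c : ℝ) (K : ℕ) (i : Fin p) :
    IdentDistrib (fun ω => branchMax p c K fun k m => η (k + 1) (i + p * m) ω)
      (fun ω => branchMax p c K fun k m => η k m ω) P P := by
  have hp : 0 < p := i.pos
  let σ : TreeIndex p → TreeIndex p := fun j =>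
    ⟨(j.1.1 + 1, i + p * j.1.2), by have := j.2.1; simp, child_lt i j.2.2⟩
  have hσ : σ.Injective := by
    rintro ⟨⟨k, m⟩, h⟩ ⟨⟨k', m'⟩, h'⟩ hj
    simp only [σ, Subtype.mk.injEq, Prod.mk.injEq, add_left_inj, add_right_inj] at hj ⊢
    exact ⟨hj.1, Nat.eq_of_mul_eq_mul_left hp hj.2⟩
  have h := IdentDistrib.pi (X := fun (j : TreeIndex p) => η (σ j).1.1 (σ j).1.2)
    (Y := fun (j : TreeIndex p) => η j.1.1 j.1.2) (μ := P) (ν := P)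
    (fun j => (hη.identDistrib _ _ (σ j).2.1 (σ j).2.2).trans
      (hη.identDistrib _ _ j.2.1 j.2.2).symm) (hη.indep.precomp hσ) hη.indep
  have h' := h.comp ((measurable_branchMax p c K).comp (measurable_extendArray p))
  convert h' using 1
  · funext ω
    exact branchMax_congr fun k m hk hm => by simp [extendArray, hk, hm, σ]
  · funext ω
    exact branchMax_congr fun k m hk hm => by simp [extendArray, hk, hm]

/-- The subtree maximum reads only levels at least `2`. Rewriting it through `extendArray` shows
that entries outside the tree, about which nothing is assumed, play no role. -/
theorem indepFun_branchMax_child {Ω Ω' : Type*} [MeasurableSpace Ω] [MeasurableSpace Ω']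
    {P : Measure Ω} {P' : Measure Ω'} {p : ℕ} {η : ℕ → ℕ → Ω → ℝ}
    {Y : Ω' → ℝ} (hη : IsIIDTriangularArray P P' p η Y) (hm : ∀ k n, Measurable (η k n))
    (c : ℝ) (K : ℕ) (i : Fin p) :
    IndepFun (fun ω => branchMax p c K fun k m => η (k + 1) (i + p * m) ω) (η 1 i) P := by
  let f : TreeIndex p → Ω → ℝ := fun j => η j.1.1 j.1.2
  have e1 : (1 : ℕ) ≤ 1 ∧ (i : ℕ) < p ^ 1 := by simp
  refine indepFun_of_measurable_iSup_comap (f := f) hη.indep (fun j => hm _ _)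
    (S := {j | 2 ≤ j.1.1}) (T := {j | j.1.1 = 1}) ?_ ?_
    (measurable_iSup_comap f (i := ⟨(1, i), e1⟩) rfl)
  · rw [Set.disjoint_left]
    intro j h1 h2
    simp only [Set.mem_ofPred_eq] at h1 h2
    omega
  · have h : (fun ω => branchMax p c K fun k m => η (k + 1) (i + p * m) ω) = fun ω =>
        branchMax p c K (extendArray p fun j => η (j.1.1 + 1) (i + p * j.1.2) ω) := by
      funext ω
      exact branchMax_congr fun k m hk hm => by simp [extendArray, hk, hm]
    rw [h]
    have hx : Measurable[⨆ j ∈ {j : TreeIndex p | 2 ≤ j.1.1},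
        MeasurableSpace.comap (f j) inferInstance]
        fun ω (j : TreeIndex p) => η (j.1.1 + 1) (i + p * j.1.2) ω := by
      refine @measurable_pi_lambda _ _ _ (_) _ _ fun j => ?_
      exact measurable_iSup_comap f (S := {j | 2 ≤ j.1.1})
        (i := ⟨(j.1.1 + 1, i + p * j.1.2), by simp, child_lt i j.2.2⟩)
        (by have := j.2.1; simp only [Set.mem_ofPred_eq]; omega)
    have hE : Measurable fun x => branchMax p c K (extendArray p x) :=
      (measurable_branchMax p c K).comp (measurable_extendArray p)
    exact hE.comp hx

/-- The maximum is attained at some child, so its image under `φ` is one of the nonnegative summands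
on the right. -/
theorem lintegral_branchMax_succ_le {Ω : Type*} [MeasurableSpace Ω] {P : Measure Ω} {p : ℕ}
    [NeZero p] {c : ℝ} {η : ℕ → ℕ → Ω → ℝ} (hm : ∀ k n, Measurable (η k n)) (K : ℕ)
    {φ : ℝ → ENNReal} (hφ : Measurable φ) :
    ∫⁻ ω, φ (branchMax p c (K + 1) fun k m => η k m ω) ∂P ≤
      ∑ i : Fin p, ∫⁻ ω, φ (c * (η 1 i ω + branchMax p c K fun k m => η (k + 1) (i + p * m) ω)) ∂P := by
  rw [← lintegral_finsetSum]
  · refine lintegral_mono fun ω => ?_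
    obtain ⟨i, hi⟩ := exists_eq_ciSup_of_finite (f := fun i : Fin p =>
      η 1 i ω + branchMax p c K fun k m => η (k + 1) (i + p * m) ω)
    simp only [branchMax]
    rw [← hi]
    exact Finset.single_le_sum (f := fun i : Fin p =>
      φ (c * (η 1 i ω + branchMax p c K fun k m => η (k + 1) (i + p * m) ω)))
      (fun _ _ => zero_le) (Finset.mem_univ i)
  · intro i _
    refine hφ.comp (Measurable.const_mul ((hm _ _).add ((measurable_branchMax p c K).comp ?_)) c)
    fun_prop

/-! ### Drift inequality and tightness of the branch maximum -/

section Tree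

variable {Ω Ω' : Type*} [MeasurableSpace Ω] [MeasurableSpace Ω'] {P : Measure Ω} {P' : Measure Ω'} {p : ℕ} {η : ℕ → ℕ → Ω → ℝ} {Y : Ω' → ℝ} {c q : ℝ}

theorem IsIIDTriangularArray.lintegral_comp_eq (hη : IsIIDTriangularArray P P' p η Y) {k n : ℕ}
    (hk : 1 ≤ k) (hn : n < p ^ k) {g : ℝ → ENNReal} (hg : Measurable g) :
    ∫⁻ ω, g (η k n ω) ∂P = ∫⁻ ω, g (Y ω) ∂P' :=
  ((hη.identDistrib k n hk hn).comp hg).lintegral_eq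

theorem measurable_branchMax_array (hm : ∀ k n, Measurable (η k n)) (c : ℝ) (K : ℕ) :
    Measurable fun ω => branchMax p c K fun k m => η k m ω :=
  (measurable_branchMax p c K).comp (by fun_prop)

theorem measurable_branchMax_child (hm : ∀ k n, Measurable (η k n)) (c : ℝ) (K i : ℕ) :
    Measurable fun ω => branchMax p c K fun k m => η (k + 1) (i + p * m) ω :=
  (measurable_branchMax p c K).comp (by fun_prop)

/-- Only finiteness for each `K` is claimed, with no uniformity; it permits cancelling the common
term of the drift inequality. -/
theorem lintegral_branchMax_rpow_ne_top [IsProbabilityMeasure P] [NeZero p] (hη : IsIIDTriangularArray P P' p η Y)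
    (hm : ∀ k n, Measurable (η k n)) (h0 : ∀ k n ω, 0 ≤ η k n ω) (hc : 0 ≤ c) (hq : 1 ≤ q)
    (hY : ∫⁻ ω, ENNReal.ofReal (Y ω ^ q) ∂P' ≠ ⊤) (K : ℕ) :
    ∫⁻ ω, ENNReal.ofReal ((branchMax p c K fun k m => η k m ω) ^ q) ∂P ≠ ⊤ := by
  induction K with
  | zero => simp [branchMax, Real.zero_rpow (show q ≠ 0 by linarith)]
  | succ K ih =>
    refine ne_top_of_le_ne_top ?_ (lintegral_branchMax_succ_le hm K
      (φ := fun x => ENNReal.ofReal (x ^ q)) (by fun_prop))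
    refine (ENNReal.sum_lt_top.2 fun i _ => ?_).ne
    have h1 : (1 : ℕ) ≤ 1 ∧ (i : ℕ) < p ^ 1 := by simp
    have hle : ∀ ω, ENNReal.ofReal
        ((c * (η 1 i ω + branchMax p c K fun k m => η (k + 1) (i + p * m) ω)) ^ q) ≤
        ENNReal.ofReal (c ^ q * 2 ^ q) * (ENNReal.ofReal (η 1 i ω ^ q) +
          ENNReal.ofReal ((branchMax p c K fun k m => η (k + 1) (i + p * m) ω) ^ q)) := fun ω => by
      have hw := branchMax_nonneg (p := p) hc K (z := fun k m => η (k + 1) (i + p * m) ω)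
        fun _ _ => h0 _ _ _
      have hz := h0 1 i ω
      have hcq := Real.rpow_nonneg hc q
      rw [← ENNReal.ofReal_add (by positivity) (by positivity), ← ENNReal.ofReal_mul (by positivity),
        Real.mul_rpow hc (by positivity), mul_assoc]
      gcongr
      exact add_rpow_le_two_rpow_mul (by linarith) hz hw
    refine (lintegral_mono hle).trans_lt ?_
    have hz : Measurable fun ω => ENNReal.ofReal (η 1 i ω ^ q) :=
      ((hm 1 i).pow_const q).ennreal_ofReal
    have hg : Measurable fun x : ℝ => ENNReal.ofReal (x ^ q) := by fun_prop
    have hid := ((identDistrib_branchMax_child hη c K i).comp hg).lintegral_eq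
    simp only [Function.comp_def] at hid
    rw [lintegral_const_mul' _ _ ENNReal.ofReal_ne_top, lintegral_add_left hz, hid,
      hη.lintegral_comp_eq h1.1 h1.2 hg]
    exact ENNReal.mul_lt_top ENNReal.ofReal_lt_top
      (ENNReal.add_lt_top.2 ⟨hY.lt_top, ih.lt_top⟩)

/-- One step of the recursion, tested against the truncated power `x ↦ max (x - a) 0 ^ q`. -/
theorem lintegral_branchMax_drift_le [IsProbabilityMeasure P] [NeZero p] (hη : IsIIDTriangularArray P P' p η Y)
    (hm : ∀ k n, Measurable (η k n)) (h0 : ∀ k n ω, 0 ≤ η k n ω) (hc : 0 ≤ c) (hq : 1 ≤ q)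
    (hpc : p * c ^ q = 1) {a s : ℝ} (hs : 0 ≤ s) (has : c * (a + s) = a) (K : ℕ) :
    ∫⁻ ω, ENNReal.ofReal (max ((branchMax p c K fun k m => η k m ω) - a - s) 0 ^ q) ∂P +
        ENNReal.ofReal (q * s) *
          ∫⁻ ω, ENNReal.ofReal (posPow q (max ((branchMax p c K fun k m => η k m ω) - a - s) 0)) ∂P ≤
      ∫⁻ ω, ENNReal.ofReal (max ((branchMax p c K fun k m => η k m ω) - a - s) 0 ^ q) ∂P +
        ENNReal.ofReal (q * 2 ^ (q - 1)) *
          ((∫⁻ ω, ENNReal.ofReal (posPow q (max ((branchMax p c K fun k m => η k m ω) - a - s) 0)) ∂P) *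
            ∫⁻ ω, ENNReal.ofReal (Y ω) ∂P' + ∫⁻ ω, ENNReal.ofReal (Y ω ^ q) ∂P') := by
  set gA : ℝ → ENNReal := fun x => ENNReal.ofReal (max (x - a - s) 0 ^ q) with hgA
  set gD : ℝ → ENNReal := fun x => ENNReal.ofReal (posPow q (max (x - a - s) 0)) with hgD
  set φ : ℝ → ENNReal := fun x => ENNReal.ofReal (max (x - a) 0 ^ q) with hφ
  have mA : Measurable gA := by fun_prop
  have mD : Measurable gD := ((measurable_posPow q).comp (by fun_prop)).ennreal_ofReal
  have mφ : Measurable φ := by fun_prop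
  have mq : Measurable fun x : ℝ => ENNReal.ofReal (x ^ q) := by fun_prop
  have mW := measurable_branchMax_array (p := p) hm c K
  have hcq : 0 ≤ c ^ q := Real.rpow_nonneg hc q
  have hlow : ∀ x, gA x + ENNReal.ofReal (q * s) * gD x ≤ φ x := fun x => by
    simp only [hgA, hgD, hφ]
    rw [← ENNReal.ofReal_mul (by positivity),
      ← ENNReal.ofReal_add (by positivity) (mul_nonneg (by positivity) (posPow_nonneg _ _))]
    exact ENNReal.ofReal_le_ofReal (rpow_add_posPow_le hq hs)
  have hup : ∀ z w, 0 ≤ z → φ (c * (z + w)) ≤ ENNReal.ofReal (c ^ q) * (gA w +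
      ENNReal.ofReal (q * 2 ^ (q - 1)) * (gD w * ENNReal.ofReal z + ENNReal.ofReal (z ^ q))) := by
    intro z w hz
    have hD := posPow_nonneg q (max (w - a - s) 0)
    simp only [hgA, hgD, hφ]
    rw [← ENNReal.ofReal_mul hD, ← ENNReal.ofReal_add (by positivity) (by positivity),
      ← ENNReal.ofReal_mul (by positivity), ← ENNReal.ofReal_add (by positivity) (by positivity),
      ← ENNReal.ofReal_mul hcq]
    refine ENNReal.ofReal_le_ofReal ?_
    -- The relation `c * (a + s) = a` turns subtracting `a` after scaling into subtracting `a + s`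
    -- before it.
    have h1 : max (c * (z + w) - a) 0 ≤ c * (max (w - a - s) 0 + z) := by
      refine max_le ?_ (by positivity)
      calc c * (z + w) - a = c * (w - a - s + z) := by linear_combination has
        _ ≤ _ := by gcongr; exact le_max_left _ _
    calc max (c * (z + w) - a) 0 ^ q ≤ (c * (max (w - a - s) 0 + z)) ^ q :=
          Real.rpow_le_rpow (le_max_right _ _) h1 (by linarith)
      _ = c ^ q * (max (w - a - s) 0 + z) ^ q := Real.mul_rpow hc (by positivity)
      _ ≤ _ := by gcongr; exact add_rpow_le_posPow hq (le_max_right _ _) hz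
  have hchild : ∀ i : Fin p,
      ∫⁻ ω, φ (c * (η 1 i ω + branchMax p c K fun k m => η (k + 1) (i + p * m) ω)) ∂P ≤
      ENNReal.ofReal (c ^ q) * (∫⁻ ω, gA (branchMax p c K fun k m => η k m ω) ∂P +
        ENNReal.ofReal (q * 2 ^ (q - 1)) *
          ((∫⁻ ω, gD (branchMax p c K fun k m => η k m ω) ∂P) *
            ∫⁻ ω, ENNReal.ofReal (Y ω) ∂P' + ∫⁻ ω, ENNReal.ofReal (Y ω ^ q) ∂P')) := by
    intro i
    have h1 : (1 : ℕ) ≤ 1 ∧ (i : ℕ) < p ^ 1 := by simp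
    have mU := measurable_branchMax_child (p := p) hm c K i
    have idA := ((identDistrib_branchMax_child hη c K i).comp mA).lintegral_eq
    have idD := ((identDistrib_branchMax_child hη c K i).comp mD).lintegral_eq
    have hind := lintegral_mul_eq_lintegral_mul_lintegral_of_indepFun (mD.comp mU)
      (hm 1 i).ennreal_ofReal
      ((indepFun_branchMax_child hη hm c K i).comp mD ENNReal.measurable_ofReal)
    simp only [Function.comp_def, Pi.mul_apply] at idA idD hind
    have mAU : Measurable fun ω => gA (branchMax p c K fun k m => η (k + 1) (i + p * m) ω) :=
      mA.comp mU
    have mDU : Measurable fun ω => gD (branchMax p c K fun k m => η (k + 1) (i + p * m) ω) *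
        ENNReal.ofReal (η 1 i ω) := (mD.comp mU).mul (hm 1 i).ennreal_ofReal
    refine (lintegral_mono fun ω => hup _ _ (h0 1 i ω)).trans_eq ?_
    rw [lintegral_const_mul' _ _ ENNReal.ofReal_ne_top, lintegral_add_left mAU,
      lintegral_const_mul' _ _ ENNReal.ofReal_ne_top,
      lintegral_add_left mDU, hind, idA, idD,
      hη.lintegral_comp_eq h1.1 h1.2 mq, hη.lintegral_comp_eq h1.1 h1.2 ENNReal.measurable_ofReal]
  have mAW : Measurable fun ω => gA (branchMax p c K fun k m => η k m ω) := mA.comp mW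
  calc _ = ∫⁻ ω, (gA (branchMax p c K fun k m => η k m ω) +
        ENNReal.ofReal (q * s) * gD (branchMax p c K fun k m => η k m ω)) ∂P := by
        rw [lintegral_add_left mAW, lintegral_const_mul' _ _ ENNReal.ofReal_ne_top]
    _ ≤ ∫⁻ ω, φ (branchMax p c K fun k m => η k m ω) ∂P := lintegral_mono fun ω => hlow _
    -- Monotonicity in the depth closes the loop: both ends of the chain involve depth `K` only.
    _ ≤ ∫⁻ ω, φ (branchMax p c (K + 1) fun k m => η k m ω) ∂P := by
        refine lintegral_mono fun ω => ENNReal.ofReal_le_ofReal ?_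
        have := branchMax_le_succ (p := p) hc K (z := fun k m => η k m ω) fun _ _ => h0 _ _ _
        gcongr
    _ ≤ _ := lintegral_branchMax_succ_le hm K mφ
    _ ≤ _ := Finset.sum_le_sum fun i _ => hchild i
    _ = _ := by
        -- The `p` children, each with factor `c ^ q`, have total weight exactly `1`.
        rw [Finset.sum_const, Finset.card_univ, Fintype.card_fin, nsmul_eq_mul, ← mul_assoc,
          ← ENNReal.ofReal_natCast, ← ENNReal.ofReal_mul (by positivity), hpc, ENNReal.ofReal_one,
          one_mul]

theorem exists_measure_branchMax_le [IsProbabilityMeasure P] [NeZero p] (hη : IsIIDTriangularArray P P' p η Y)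
    (hm : ∀ k n, Measurable (η k n)) (h0 : ∀ k n ω, 0 ≤ η k n ω) (hc : 0 ≤ c) (hc1 : c < 1)
    (hq : 1 ≤ q) (hpc : p * c ^ q = 1) (hY1 : ∫⁻ ω, ENNReal.ofReal (Y ω) ∂P' ≠ ⊤)
    (hYq : ∫⁻ ω, ENNReal.ofReal (Y ω ^ q) ∂P' ≠ ⊤) {ε : ℝ} (hε : 0 < ε) :
    ∃ t : ℝ, ∀ K, P {ω | t ≤ branchMax p c K fun k m => η k m ω} ≤ ENNReal.ofReal ε := by
  set e₁ := (∫⁻ ω, ENNReal.ofReal (Y ω) ∂P').toReal with he₁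
  set e₂ := (∫⁻ ω, ENNReal.ofReal (Y ω ^ q) ∂P').toReal with he₂
  set C : ℝ := q * 2 ^ (q - 1) with hC
  have hC0 : 0 < C := by positivity
  have he₁0 : 0 ≤ e₁ := ENNReal.toReal_nonneg
  have he₂0 : 0 ≤ e₂ := ENNReal.toReal_nonneg
  -- The first summand absorbs the cost `C * d * e₁`; the second leaves enough drift to force `d ≤
  -- ε`. Using `e₂ + 1` keeps `s` positive.
  set s : ℝ := (C * e₁ + C * (e₂ + 1) / ε) / q with hs
  have hs0 : 0 < s := by positivity
  have hqs : q * s = C * e₁ + C * (e₂ + 1) / ε := by rw [hs]; field_simp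
  set a : ℝ := c * s / (1 - c) with ha
  have h1c : 0 < 1 - c := by linarith
  have ha0 : 0 ≤ a := by positivity
  have has : c * (a + s) = a := by rw [ha]; field_simp; ring
  -- Beyond this level the excess over `a + s` is at least `1`, hence so is its `posPow`, and
  -- Markov's inequality applies.
  refine ⟨a + s + 1, fun K => ?_⟩
  have hdrift := lintegral_branchMax_drift_le hη hm h0 hc hq hpc hs0.le has K
  have hWq := lintegral_branchMax_rpow_ne_top hη hm h0 hc hq hYq K
  have hW0 : ∀ ω, 0 ≤ branchMax p c K fun k m => η k m ω :=
    fun ω => branchMax_nonneg hc K fun _ _ => h0 _ _ _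
  have mW := measurable_branchMax_array (p := p) hm c K
  set W : Ω → ℝ := fun ω => branchMax p c K fun k m => η k m ω
  have hle : ∀ ω, max (W ω - a - s) 0 ^ q + q * s * posPow q (max (W ω - a - s) 0) ≤ W ω ^ q := by
    intro ω
    refine (rpow_add_posPow_le hq hs0.le).trans ?_
    have : max (W ω - a) 0 ≤ W ω := max_le (by linarith) (hW0 ω)
    gcongr
  have hA : ∫⁻ ω, ENNReal.ofReal (max (W ω - a - s) 0 ^ q) ∂P ≠ ⊤ := by
    refine ne_top_of_le_ne_top hWq (lintegral_mono fun ω => ENNReal.ofReal_le_ofReal ?_)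
    have := mul_nonneg (show 0 ≤ q * s by positivity) (posPow_nonneg q (max (W ω - a - s) 0))
    linarith [hle ω]
  have hD : ∫⁻ ω, ENNReal.ofReal (posPow q (max (W ω - a - s) 0)) ∂P ≠ ⊤ := by
    have h1 : ENNReal.ofReal (q * s) * ∫⁻ ω, ENNReal.ofReal (posPow q (max (W ω - a - s) 0)) ∂P ≤
        ∫⁻ ω, ENNReal.ofReal (W ω ^ q) ∂P := by
      rw [← lintegral_const_mul' _ _ ENNReal.ofReal_ne_top]
      refine lintegral_mono fun ω => ?_
      rw [← ENNReal.ofReal_mul (by positivity)]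
      refine ENNReal.ofReal_le_ofReal ?_
      have := Real.rpow_nonneg (le_max_right (W ω - a - s) 0) q
      linarith [hle ω]
    intro htop
    rw [htop, ENNReal.mul_top (by simpa using by positivity)] at h1
    exact hWq (top_le_iff.1 h1)
  set d := (∫⁻ ω, ENNReal.ofReal (posPow q (max (W ω - a - s) 0)) ∂P).toReal with hd
  have hd0 : 0 ≤ d := ENNReal.toReal_nonneg
  have hreal : q * s * d ≤ C * (d * e₁ + e₂) := by
    have h2 := (ENNReal.add_le_add_iff_left hA).1 hdrift
    have h3 := ENNReal.toReal_mono (ENNReal.mul_ne_top ENNReal.ofReal_ne_top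
      (ENNReal.add_ne_top.2 ⟨ENNReal.mul_ne_top hD hY1, hYq⟩)) h2
    rwa [ENNReal.toReal_mul, ENNReal.toReal_mul, ENNReal.toReal_add (ENNReal.mul_ne_top hD hY1) hYq,
      ENNReal.toReal_mul, ENNReal.toReal_ofReal (by positivity), ENNReal.toReal_ofReal hC0.le] at h3
  have hdε : d ≤ ε := by
    rw [hqs] at hreal
    have h4 : C * (e₂ + 1) / ε * d ≤ C * (e₂ + 1) := by nlinarith
    have h5 : C * (e₂ + 1) * (d / ε) ≤ C * (e₂ + 1) * 1 := by
      calc _ = C * (e₂ + 1) / ε * d := by ring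
        _ ≤ _ := by linarith
    have h6 := le_of_mul_le_mul_left h5 (by positivity)
    rwa [div_le_one hε] at h6
  have mD : Measurable fun ω => ENNReal.ofReal (posPow q (max (W ω - a - s) 0)) :=
    ((measurable_posPow q).comp (by fun_prop)).ennreal_ofReal
  calc P {ω | a + s + 1 ≤ W ω} ≤
        P {ω | 1 ≤ ENNReal.ofReal (posPow q (max (W ω - a - s) 0))} := by
        refine measure_mono fun ω hω => ?_
        simp only [Set.mem_ofPred_eq] at hω ⊢
        rw [ENNReal.one_le_ofReal]
        exact one_le_posPow hq (le_max_of_le_left (by linarith))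
    _ ≤ ∫⁻ ω, ENNReal.ofReal (posPow q (max (W ω - a - s) 0)) ∂P := by
        simpa using mul_meas_ge_le_lintegral mD 1
    _ = ENNReal.ofReal d := (ENNReal.ofReal_toReal hD).symm
    _ ≤ ENNReal.ofReal ε := ENNReal.ofReal_le_ofReal hdε

/-- If `p * c ^ q = 1` and `E[Y ^ q] < ∞`, the sums along the branches of the tree are almost surely
bounded. -/
theorem ae_exists_forall_sum_le [IsProbabilityMeasure P] [NeZero p] (hη : IsIIDTriangularArray P P' p η Y)
    (hm : ∀ k n, Measurable (η k n)) (h0 : ∀ k n ω, 0 ≤ η k n ω) (hc : 0 ≤ c) (hc1 : c < 1)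
    (hq : 1 ≤ q) (hpc : p * c ^ q = 1) (hY1 : ∫⁻ ω, ENNReal.ofReal (Y ω) ∂P' ≠ ⊤)
    (hYq : ∫⁻ ω, ENNReal.ofReal (Y ω ^ q) ∂P' ≠ ⊤) :
    ∀ᵐ ω ∂P, ∃ B : ℝ, ∀ n K, ∑ k ∈ Finset.range K, c ^ (k + 1) * periodicExt p η (k + 1) n ω ≤ B := by
  have hmono : ∀ ω, Monotone fun K => branchMax p c K fun k m => η k m ω :=
    fun ω => monotone_nat_of_le_succ fun K => branchMax_le_succ hc K fun _ _ => h0 _ _ _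
  -- The exceedance events increase with `K`, so the bound uniform in `K` passes to their union.
  have hnull : P {ω | ∀ t : ℝ, ∃ K, t ≤ branchMax p c K fun k m => η k m ω} = 0 := by
    refine le_antisymm (ENNReal.le_of_forall_pos_le_add fun ε hε _ => ?_) zero_le
    obtain ⟨t, ht⟩ := exists_measure_branchMax_le hη hm h0 hc hc1 hq hpc hY1 hYq (ε := ε) hε
    calc _ ≤ P (⋃ K, {ω | t ≤ branchMax p c K fun k m => η k m ω}) :=
          measure_mono fun ω (hω : ∀ t : ℝ, ∃ K, t ≤ branchMax p c K fun k m => η k m ω) =>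
            Set.mem_iUnion.2 (hω t)
      _ = ⨆ K, P {ω | t ≤ branchMax p c K fun k m => η k m ω} :=
          Monotone.measure_iUnion fun K L hKL ω hω => le_trans hω (hmono ω hKL)
      _ ≤ _ := by simpa using ht
  filter_upwards [measure_eq_zero_iff_ae_notMem.1 hnull] with ω hω
  simp only [not_forall, not_exists, not_le] at hω
  obtain ⟨B, hB⟩ := hω
  exact ⟨B, fun n K => (sum_le_branchMax hc K n fun k m => η k m ω).trans (hB K).le⟩

end Tree

/-! ### Summability of the series -/

theorem tsum_rpow_le_tsum_rpow {ι : Type*} (f : ι → ENNReal) {α : ℝ} (hα : 0 < α) (hα1 : α ≤ 1) :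
    (∑' i, f i) ^ α ≤ ∑' i, f i ^ α := by
  rw [← ENNReal.le_rpow_inv_iff hα, ENNReal.tsum_eq_iSup_sum]
  refine iSup_le fun s => ?_
  rw [ENNReal.le_rpow_inv_iff hα]
  refine le_trans ?_ (ENNReal.sum_le_tsum s)
  classical
  induction s using Finset.induction_on with
  | empty => simp [ENNReal.zero_rpow_of_pos hα]
  | insert a s ha ih =>
    rw [Finset.sum_insert ha, Finset.sum_insert ha]
    exact (ENNReal.rpow_add_le_add_rpow _ _ hα.le hα1).trans (by gcongr)

theorem sum_rpow_le_sum_rpow {ι : Type*} (s : Finset ι) (f : ι → ℝ) (hf : ∀ i, 0 ≤ f i) {α : ℝ}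
    (hα : 0 < α) (hα1 : α ≤ 1) : (∑ i ∈ s, f i) ^ α ≤ ∑ i ∈ s, f i ^ α := by
  classical
  induction s using Finset.induction_on with
  | empty => simp [Real.zero_rpow hα.ne']
  | insert a s ha ih =>
    rw [Finset.sum_insert ha, Finset.sum_insert ha]
    exact (Real.rpow_add_le_add_rpow (hf a) (Finset.sum_nonneg fun i _ => hf i) hα.le hα1).trans
      (by gcongr)

theorem lintegral_abs_rpow_ne_top_of_le {Ω' : Type*} [MeasurableSpace Ω'] {P' : Measure Ω'}
    [IsFiniteMeasure P'] {Y : Ω' → ℝ} {α β : ℝ} (hα : 0 ≤ α) (hαβ : α ≤ β)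
    (hY : ∫⁻ ω, ENNReal.ofReal (|Y ω| ^ β) ∂P' ≠ ⊤) :
    ∫⁻ ω, ENNReal.ofReal (|Y ω| ^ α) ∂P' ≠ ⊤ := by
  have hle : ∀ ω, ENNReal.ofReal (|Y ω| ^ α) ≤ 1 + ENNReal.ofReal (|Y ω| ^ β) := by
    intro ω
    rw [← ENNReal.ofReal_one, ← ENNReal.ofReal_add zero_le_one (by positivity)]
    refine ENNReal.ofReal_le_ofReal ?_
    rcases le_total |Y ω| 1 with h | h
    · have h1 := Real.rpow_le_one (abs_nonneg _) h hα
      have h2 : 0 ≤ |Y ω| ^ β := by positivity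
      linarith
    · have := Real.rpow_le_rpow_of_exponent_le h hαβ
      linarith
  refine ne_top_of_le_ne_top ?_ (lintegral_mono hle)
  rw [lintegral_add_left measurable_const]
  simpa using hY

theorem integrable_abs_rpow_iff {Ω' : Type*} [MeasurableSpace Ω'] {P' : Measure Ω'} {Y : Ω' → ℝ}
    (hY : AEMeasurable Y P') (q : ℝ) :
    Integrable (fun ω => |Y ω| ^ q) P' ↔ ∫⁻ ω, ENNReal.ofReal (|Y ω| ^ q) ∂P' ≠ ⊤ := by
  have hm : AEStronglyMeasurable (fun ω => |Y ω| ^ q) P' :=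
    ((measurable_id.abs.pow_const q).comp_aemeasurable hY).aestronglyMeasurable
  rw [Integrable, and_iff_right hm,
    hasFiniteIntegral_iff_ofReal (Filter.Eventually.of_forall fun ω => by positivity), lt_top_iff_ne_top]

/-- The sum of `c ^ j * |Y^{k+j}_n|` over `j ≥ 0`, as an extended nonnegative real. -/
noncomputable def tailSum {Ω : Type*} (p : ℕ) (c : ℝ) (η : ℕ → ℕ → Ω → ℝ) (k n : ℕ) (ω : Ω) :
    ENNReal :=
  ∑' j, ENNReal.ofReal (c ^ j * |periodicExt p η (k + j) n ω|)

theorem summable_term {Ω : Type*} {p : ℕ} {η : ℕ → ℕ → Ω → ℝ} {c : ℝ} {ω : Ω} (hc : 0 ≤ c)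
    (hs : ∀ n, Summable fun k => c ^ (k + 1) * |periodicExt p η (k + 1) n ω|) (n : ℕ) :
    Summable fun k => c ^ (k + 1) * periodicExt p η (k + 1) n ω := by
  refine Summable.of_norm_bounded (hs n) fun k => ?_
  rw [Real.norm_eq_abs, abs_mul, abs_of_nonneg (by positivity)]

theorem process_eq_sub {Ω : Type*} {p : ℕ} {η : ℕ → ℕ → Ω → ℝ} {c : ℝ} {ω : Ω} (hc : 0 ≤ c)
    (hs : ∀ n, Summable fun k => c ^ (k + 1) * |periodicExt p η (k + 1) n ω|) (n : ℕ) :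
    process p c η n ω = ∑' k, c ^ (k + 1) * periodicExt p η (k + 1) n ω -
      ∑' k, c ^ (k + 1) * periodicExt p η (k + 1) 0 ω := by
  rw [← (summable_term hc hs n).tsum_sub (summable_term hc hs 0)]
  exact tsum_congr fun k => mul_sub _ _ _

theorem bddAbove_process_of_forall_sum_le {Ω : Type*} {p : ℕ} {η : ℕ → ℕ → Ω → ℝ} {c : ℝ} {ω : Ω} (hc : 0 ≤ c)
    (hs : ∀ n, Summable fun k => c ^ (k + 1) * |periodicExt p η (k + 1) n ω|) {B : ℝ}
    (hB : ∀ n K, ∑ k ∈ Finset.range K, c ^ (k + 1) * |periodicExt p η (k + 1) n ω| ≤ B) :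
    BddAbove (Set.range fun n => |process p c η n ω|) := by
  have h1 : ∀ n, |∑' k, c ^ (k + 1) * periodicExt p η (k + 1) n ω| ≤ B := by
    intro n
    have hf : ∀ k, ‖c ^ (k + 1) * periodicExt p η (k + 1) n ω‖ =
        c ^ (k + 1) * |periodicExt p η (k + 1) n ω| := fun k => by
      rw [Real.norm_eq_abs, abs_mul, abs_of_nonneg (by positivity)]
    refine (norm_tsum_le_tsum_norm ((summable_congr hf).2 (hs n))).trans ?_
    simp only [hf]
    exact Real.tsum_le_of_sum_range_le (fun k => by positivity) (hB n)
  refine ⟨B + B, ?_⟩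
  rintro _ ⟨n, rfl⟩
  simp only
  rw [process_eq_sub hc hs]
  exact (abs_sub _ _).trans (add_le_add (h1 n) (h1 0))

/-! ### Uniform control of the tails, and sufficiency of the moment condition -/

section Series

variable {Ω Ω' : Type*} [MeasurableSpace Ω] [MeasurableSpace Ω'] {P : Measure Ω} {P' : Measure Ω'}
  {p : ℕ} {η : ℕ → ℕ → Ω → ℝ} {Y : Ω' → ℝ} {c α : ℝ}

theorem measurable_tailSum (hm : ∀ k n, Measurable (η k n)) (k n : ℕ) :
    Measurable (tailSum p c η k n) := by
  refine Measurable.tsum fun j => ?_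
  have : Measurable (periodicExt p η (k + j) n) := hm _ _
  fun_prop

/-- For `α ≤ 1` the power is subadditive, so a fractional moment suffices, and the weights sum as a
geometric series of ratio `c ^ α`. The bound does not depend on `k` or `n`. -/
theorem lintegral_tailSum_rpow_le [NeZero p] (hη : IsIIDTriangularArray P P' p η Y)
    (hm : ∀ k n, Measurable (η k n)) (hc : 0 ≤ c) (hα : 0 < α) (hα1 : α ≤ 1) {k : ℕ} (hk : 1 ≤ k)
    (n : ℕ) :
    ∫⁻ ω, tailSum p c η k n ω ^ α ∂P ≤
      (1 - ENNReal.ofReal (c ^ α))⁻¹ * ∫⁻ ω, ENNReal.ofReal (|Y ω| ^ α) ∂P' := by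
  have hle : ∀ ω, tailSum p c η k n ω ^ α ≤
      ∑' j, ENNReal.ofReal (c ^ α) ^ j * ENNReal.ofReal (|periodicExt p η (k + j) n ω| ^ α) := by
    intro ω
    refine (tsum_rpow_le_tsum_rpow _ hα hα1).trans_eq (tsum_congr fun j => ?_)
    rw [ENNReal.ofReal_rpow_of_nonneg (by positivity) hα.le, Real.mul_rpow (by positivity)
      (abs_nonneg _), ENNReal.ofReal_mul (by positivity), ← ENNReal.ofReal_pow (by positivity),
      ← Real.rpow_natCast, ← Real.rpow_natCast, ← Real.rpow_mul hc, ← Real.rpow_mul hc, mul_comm α]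
  have hg : Measurable fun x : ℝ => ENNReal.ofReal (|x| ^ α) := by fun_prop
  have hmj : ∀ j, Measurable fun ω =>
      ENNReal.ofReal (c ^ α) ^ j * ENNReal.ofReal (|periodicExt p η (k + j) n ω| ^ α) :=
    fun j => Measurable.const_mul (hg.comp (hm _ _)) _
  refine (lintegral_mono hle).trans_eq ?_
  rw [lintegral_tsum fun j => (hmj j).aemeasurable,
    ← ENNReal.tsum_geometric, ← ENNReal.tsum_mul_right]
  refine tsum_congr fun j => ?_
  rw [lintegral_const_mul' _ _ (by finiteness)]
  congr 1
  exact hη.lintegral_comp_eq (by omega) (Nat.mod_lt _ (pow_pos (NeZero.pos p) _)) hg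

theorem exists_measure_tailSum_le [NeZero p] (hη : IsIIDTriangularArray P P' p η Y)
    (hm : ∀ k n, Measurable (η k n)) (hc : 0 ≤ c) (hc1 : c < 1) (hα : 0 < α) (hα1 : α ≤ 1)
    (hY : ∫⁻ ω, ENNReal.ofReal (|Y ω| ^ α) ∂P' ≠ ⊤) :
    ∃ M : ENNReal, M ≠ ⊤ ∧ ∀ k n, 1 ≤ k → P {ω | M < tailSum p c η k n ω} ≤ 4⁻¹ := by
  set C : ENNReal := (1 - ENNReal.ofReal (c ^ α))⁻¹ * ∫⁻ ω, ENNReal.ofReal (|Y ω| ^ α) ∂P' with hC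
  have hCtop : C ≠ ⊤ := by
    refine ENNReal.mul_ne_top (ENNReal.inv_ne_top.2 (tsub_pos_of_lt ?_).ne') hY
    rw [ENNReal.ofReal_lt_one]
    exact Real.rpow_lt_one hc hc1 hα
  -- Markov's inequality gives `C / (4 * C + 1) ≤ 1 / 4`; the `+ 1` covers `C = 0`. The value `1 /
  -- 4` lets two tails be controlled at once with probability at least `1 / 2`.
  refine ⟨(4 * C + 1) ^ α⁻¹, by finiteness, fun k n hk => ?_⟩
  have hx0 : 4 * C + 1 ≠ 0 := by simp
  have hxt : 4 * C + 1 ≠ ⊤ := by finiteness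
  calc P {ω | (4 * C + 1) ^ α⁻¹ < tailSum p c η k n ω} ≤
        P {ω | 4 * C + 1 ≤ tailSum p c η k n ω ^ α} := by
        refine measure_mono fun ω (hω : (4 * C + 1) ^ α⁻¹ < tailSum p c η k n ω) => ?_
        exact (ENNReal.rpow_inv_le_iff hα).1 hω.le
    _ ≤ (∫⁻ ω, tailSum p c η k n ω ^ α ∂P) / (4 * C + 1) :=
        meas_ge_le_lintegral_div ((measurable_tailSum hm k n).pow_const α).aemeasurable hx0 hxt
    _ ≤ C / (4 * C + 1) := by
        gcongr
        exact lintegral_tailSum_rpow_le hη hm hc hα hα1 hk n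
    _ ≤ 4⁻¹ := by
        rw [ENNReal.div_le_iff hx0 hxt, mul_add, ← mul_assoc,
          ENNReal.inv_mul_cancel (by norm_num) (by norm_num), one_mul]
        exact le_self_add

theorem ae_summable_abs [NeZero p] (hη : IsIIDTriangularArray P P' p η Y)
    (hm : ∀ k n, Measurable (η k n)) (hc : 0 ≤ c) (hc1 : c < 1) (hα : 0 < α) (hα1 : α ≤ 1)
    (hY : ∫⁻ ω, ENNReal.ofReal (|Y ω| ^ α) ∂P' ≠ ⊤) :
    ∀ᵐ ω ∂P, ∀ n, Summable fun k => c ^ (k + 1) * |periodicExt p η (k + 1) n ω| := by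
  rw [ae_all_iff]
  intro n
  have hfin : ∫⁻ ω, tailSum p c η 1 n ω ^ α ∂P ≠ ⊤ := by
    refine ne_top_of_le_ne_top ?_ (lintegral_tailSum_rpow_le hη hm hc hα hα1 le_rfl n)
    refine ENNReal.mul_ne_top (ENNReal.inv_ne_top.2 (tsub_pos_of_lt ?_).ne') hY
    rw [ENNReal.ofReal_lt_one]
    exact Real.rpow_lt_one hc hc1 hα
  filter_upwards [ae_lt_top ((measurable_tailSum hm 1 n).pow_const α) hfin] with ω hω
  have hne : tailSum p c η 1 n ω ≠ ⊤ := fun h => by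
    rw [h, ENNReal.top_rpow_of_pos hα] at hω
    exact lt_irrefl _ hω
  have hs := (ENNReal.summable_toReal hne).mul_left c
  refine hs.congr fun k => ?_
  rw [ENNReal.toReal_ofReal (by positivity), add_comm 1 k]
  ring

/-- If `p * c ^ q = 1`, finiteness of `E[|Y| ^ q]` makes the sample paths bounded. -/
theorem hasBoundedSamplePaths_of_lintegral_ne_top [IsProbabilityMeasure P] [IsFiniteMeasure P']
    [NeZero p] (hη : IsIIDTriangularArray P P' p η Y) (hm : ∀ k n, Measurable (η k n))
    (hc : 0 < c) (hc1 : c < 1) {q : ℝ} (hq : 0 < q) (hpc : p * c ^ q = 1)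
    (hs : ∀ᵐ ω ∂P, ∀ n, Summable fun k => c ^ (k + 1) * |periodicExt p η (k + 1) n ω|)
    (hY : ∫⁻ ω, ENNReal.ofReal (|Y ω| ^ q) ∂P' ≠ ⊤) :
    HasBoundedSamplePaths P (process p c η) := by
  -- Both requirements are met: `q / r ≥ 1` for the tree argument, and `r ≤ 1` so that the `r`-th
  -- power of a sum is at most the sum of the `r`-th powers. Also `p * (c ^ r) ^ (q / r) = 1` still
  -- holds.
  set r := min q 1 with hr
  have hr0 : 0 < r := lt_min hq one_pos
  have hr1 : r ≤ 1 := min_le_right _ _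
  have hrq : 1 ≤ q / r := (one_le_div hr0).2 (min_le_left _ _)
  have hg : Measurable fun x : ℝ => |x| ^ r := by fun_prop
  have hζ : IsIIDTriangularArray P P' p (fun k n ω => |η k n ω| ^ r) fun ω => |Y ω| ^ r :=
    ⟨hη.indep.comp (fun _ x => |x| ^ r) fun _ => hg,
      fun k n hk hn => (hη.identDistrib k n hk hn).comp hg⟩
  have key := ae_exists_forall_sum_le (c := c ^ r) (q := q / r) hζ (fun k n => hg.comp (hm k n))
    (fun k n ω => by positivity) (by positivity) (Real.rpow_lt_one hc.le hc1 hr0) hrq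
    (by rwa [← Real.rpow_mul hc.le, mul_div_cancel₀ q hr0.ne'])
    (lintegral_abs_rpow_ne_top_of_le hr0.le (min_le_left _ _) hY)
    (by
      refine ne_of_eq_of_ne (lintegral_congr fun ω => ?_) hY
      rw [← Real.rpow_mul (abs_nonneg _), mul_div_cancel₀ q hr0.ne'])
  filter_upwards [key, hs] with ω ⟨B, hB⟩ hsω
  refine bddAbove_process_of_forall_sum_le hc.le hsω (B := B ^ r⁻¹) fun n K => ?_
  have hf : ∀ k, 0 ≤ c ^ (k + 1) * |periodicExt p η (k + 1) n ω| := fun k => by positivity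
  have h0 := Finset.sum_nonneg fun k (_ : k ∈ Finset.range K) => hf k
  have h1 := sum_rpow_le_sum_rpow (Finset.range K) _ hf hr0 hr1
  have h2 : ∑ k ∈ Finset.range K, (c ^ (k + 1) * |periodicExt p η (k + 1) n ω|) ^ r ≤ B := by
    refine le_of_eq_of_le (Finset.sum_congr rfl fun k _ => ?_) (hB n K)
    rw [Real.mul_rpow (by positivity) (abs_nonneg _), ← Real.rpow_natCast, ← Real.rpow_natCast,
      ← Real.rpow_mul hc.le, ← Real.rpow_mul hc.le, mul_comm r]
    rfl
  calc _ = ((∑ k ∈ Finset.range K, c ^ (k + 1) * |periodicExt p η (k + 1) n ω|) ^ r) ^ r⁻¹ := by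
        rw [← Real.rpow_mul h0, mul_inv_cancel₀ hr0.ne', Real.rpow_one]
    _ ≤ _ := Real.rpow_le_rpow (by positivity) (h1.trans h2) (by positivity)

end Series

/-! ### Necessity of the moment condition -/

/-- If each `G m` is independent of the event that `A m` is the first of the `A`s to occur, and
has probability at least `1 / 2`, then with probability at least `1 / 2` some `A m` and `G m` occur
together. -/
theorem half_le_measure_iUnion_inter {Ω : Type*} [MeasurableSpace Ω] {P : Measure Ω}
    {A G : ℕ → Set Ω} (hA : ∀ m, MeasurableSet (A m)) (hG : ∀ m, MeasurableSet (G m))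
    (hind : ∀ m, P (disjointed A m ∩ G m) = P (disjointed A m) * P (G m))
    (hG2 : ∀ m, 2⁻¹ ≤ P (G m)) (hA1 : P (⋃ m, A m) = 1) : 2⁻¹ ≤ P (⋃ m, A m ∩ G m) := by
  have hD : ∀ m, MeasurableSet (disjointed A m) := MeasurableSet.disjointed hA
  calc (2⁻¹ : ENNReal) = (∑' m, P (disjointed A m)) * 2⁻¹ := by
        rw [← measure_iUnion (disjoint_disjointed A) hD, iUnion_disjointed, hA1, one_mul]
    _ = ∑' m, P (disjointed A m) * 2⁻¹ := ENNReal.tsum_mul_right.symm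
    _ ≤ ∑' m, P (disjointed A m ∩ G m) := by
        refine ENNReal.tsum_le_tsum fun m => ?_
        rw [hind]
        gcongr
        exact hG2 m
    _ = P (⋃ m, disjointed A m ∩ G m) := by
        refine (measure_iUnion (fun i j hij => ?_) fun m => (hD m).inter (hG m)).symm
        exact (disjoint_disjointed A hij).mono Set.inter_subset_left Set.inter_subset_left
    _ ≤ _ := by
        gcongr with m
        exact disjointed_subset A m

theorem measurableSet_disjointed_of_forall_le {Ω : Type*} {m₀ : MeasurableSpace Ω} {A : ℕ → Set Ω}
    {m : ℕ} (h : ∀ i ≤ m, MeasurableSet (A i)) : MeasurableSet (disjointed A m) := by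
  rw [disjointed_eq_inter_compl]
  exact (h m le_rfl).inter (MeasurableSet.iInter fun i => MeasurableSet.iInter fun hi =>
    (h i hi.le).compl)

/-- A discrete layer-cake bound: `m + 1 < x` exactly when `m + 1 < ⌈x⌉₊`, so at least `⌈x⌉₊ - 1`
indicators equal `1`. -/
theorem ofReal_le_one_add_tsum_indicator (x : ℝ) :
    ENNReal.ofReal x ≤ 1 + ∑' m : ℕ, (Set.Ioi ((m : ℝ) + 1)).indicator 1 x := by
  have h1 : ENNReal.ofReal x ≤ (⌈x⌉₊ : ENNReal) := by
    rw [← ENNReal.ofReal_natCast]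
    exact ENNReal.ofReal_le_ofReal (Nat.le_ceil x)
  have h2 : ((⌈x⌉₊ - 1 : ℕ) : ENNReal) ≤ ∑' m : ℕ, (Set.Ioi ((m : ℝ) + 1)).indicator 1 x := by
    refine le_trans (le_of_eq ?_) (ENNReal.sum_le_tsum (Finset.range (⌈x⌉₊ - 1)))
    rw [Finset.sum_congr rfl (g := fun _ => 1)]
    · simp
    · intro m hm
      have h3 : m + 1 < ⌈x⌉₊ := by
        have := Finset.mem_range.1 hm
        omega
      rw [Set.indicator_of_mem, Pi.one_apply]
      rw [Set.mem_Ioi]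
      exact_mod_cast Nat.lt_ceil.1 h3
  calc ENNReal.ofReal x ≤ (⌈x⌉₊ : ENNReal) := h1
    _ ≤ ((1 + (⌈x⌉₊ - 1) : ℕ) : ENNReal) := by
        norm_cast
        omega
    _ = 1 + ((⌈x⌉₊ - 1 : ℕ) : ENNReal) := by push_cast; rfl
    _ ≤ _ := by gcongr

theorem tsum_measure_add_one_lt_eq_top {Ω' : Type*} [MeasurableSpace Ω'] {P' : Measure Ω'}
    [IsFiniteMeasure P'] {f : Ω' → ℝ} (hf : AEMeasurable f P')
    (htop : ∫⁻ ω, ENNReal.ofReal (f ω) ∂P' = ⊤) :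
    ∑' m : ℕ, P' {ω | (m : ℝ) + 1 < f ω} = ⊤ := by
  by_contra hne
  have hind : ∀ m : ℕ, Measurable ((Set.Ioi ((m : ℝ) + 1)).indicator (1 : ℝ → ENNReal)) :=
    fun m => measurable_one.indicator measurableSet_Ioi
  have hval : ∀ m : ℕ, ∫⁻ ω, (Set.Ioi ((m : ℝ) + 1)).indicator (1 : ℝ → ENNReal) (f ω) ∂P' =
      P' {ω | (m : ℝ) + 1 < f ω} := fun m =>
    lintegral_indicator_one₀ (s := f ⁻¹' Set.Ioi ((m : ℝ) + 1))
      (hf.nullMeasurableSet_preimage measurableSet_Ioi)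
  have hcomp : ∀ m : ℕ, AEMeasurable
      (fun ω => (Set.Ioi ((m : ℝ) + 1)).indicator (1 : ℝ → ENNReal) (f ω)) P' :=
    fun m => (hind m).comp_aemeasurable hf
  have hle := lintegral_mono (μ := P') fun ω => ofReal_le_one_add_tsum_indicator (f ω)
  rw [htop, lintegral_add_left measurable_const, lintegral_tsum hcomp] at hle
  simp only [hval, top_le_iff] at hle
  rw [lintegral_one, ENNReal.add_eq_top] at hle
  exact hle.elim (measure_ne_top P' _) hne

/-- `tailSum` carries the weights `c ^ j` instead of `c ^ (k + j)`; the lost factor `c ^ k ≤ 1` is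
not needed. -/
theorem abs_tsum_le_of_tailSum_le {Ω : Type*} {p : ℕ} {η : ℕ → ℕ → Ω → ℝ} {c : ℝ} {ω : Ω}
    (hc : 0 ≤ c) (hc1 : c ≤ 1) {k n : ℕ} {M : ENNReal} (hM : M ≠ ⊤)
    (h : tailSum p c η k n ω ≤ M) :
    |∑' j, c ^ (k + j) * periodicExt p η (k + j) n ω| ≤ M.toReal := by
  have htop : tailSum p c η k n ω ≠ ⊤ := ne_top_of_le_ne_top hM h
  have hval : ∀ j, (ENNReal.ofReal (c ^ j * |periodicExt p η (k + j) n ω|)).toReal =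
      c ^ j * |periodicExt p η (k + j) n ω| := fun j => ENNReal.toReal_ofReal (by positivity)
  have hs : Summable fun j => c ^ j * |periodicExt p η (k + j) n ω| :=
    (ENNReal.summable_toReal htop).congr hval
  have hle : ∀ j, ‖c ^ (k + j) * periodicExt p η (k + j) n ω‖ ≤
      c ^ j * |periodicExt p η (k + j) n ω| := fun j => by
    rw [Real.norm_eq_abs, abs_mul, abs_of_nonneg (by positivity)]
    gcongr ?_ * _
    exact pow_le_pow_of_le_one hc hc1 (Nat.le_add_left j k)
  calc _ ≤ ∑' j, c ^ j * |periodicExt p η (k + j) n ω| :=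
        tsum_of_norm_bounded hs.hasSum hle
    _ = (tailSum p c η k n ω).toReal := by
        rw [tailSum, ENNReal.tsum_toReal_eq fun _ => ENNReal.ofReal_ne_top]
        exact (tsum_congr hval).symm
    _ ≤ _ := ENNReal.toReal_mono hM h

/-- If `m` and `m % p ^ l` have small tails and the path is bounded, the entry of `m` at level
`l + 1` is not large: the summands of the two indices agree at the levels up to `l`. -/
theorem abs_entry_le {Ω : Type*} {p : ℕ} {η : ℕ → ℕ → Ω → ℝ} {c : ℝ} {ω : Ω}
    (hc : 0 ≤ c) (hc1 : c ≤ 1)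
    (hs : ∀ n, Summable fun k => c ^ (k + 1) * |periodicExt p η (k + 1) n ω|) {B : ℝ}
    (hB : ∀ n, |process p c η n ω| ≤ B) {l m : ℕ} {M : ENNReal} (hM : M ≠ ⊤)
    (h₁ : tailSum p c η (l + 2) m ω ≤ M) (h₂ : tailSum p c η (l + 1) (m % p ^ l) ω ≤ M) :
    c ^ (l + 1) * |periodicExt p η (l + 1) m ω| ≤ 2 * B + 2 * M.toReal := by
  have hsa := summable_term hc hs m
  have hsb := summable_term hc hs (m % p ^ l)
  have hsame : ∀ j ∈ Finset.range l, c ^ (j + 1) * periodicExt p η (j + 1) m ω =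
      c ^ (j + 1) * periodicExt p η (j + 1) (m % p ^ l) ω := by
    intro j hj
    have hj' := Finset.mem_range.1 hj
    rw [periodicExt, periodicExt, Nat.mod_mod_of_dvd _ (pow_dvd_pow p hj')]
  have ea := hsa.sum_add_tsum_nat_add (l + 1)
  have eb := hsb.sum_add_tsum_nat_add l
  rw [Finset.sum_range_succ, Finset.sum_congr rfl hsame] at ea
  have pa := process_eq_sub hc hs m
  have pb := process_eq_sub hc hs (m % p ^ l)
  have ta : ∑' i, c ^ (i + (l + 1) + 1) * periodicExt p η (i + (l + 1) + 1) m ω =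
      ∑' j, c ^ (l + 2 + j) * periodicExt p η (l + 2 + j) m ω :=
    tsum_congr fun i => by rw [show i + (l + 1) + 1 = l + 2 + i by ring]
  have tb : ∑' i, c ^ (i + l + 1) * periodicExt p η (i + l + 1) (m % p ^ l) ω =
      ∑' j, c ^ (l + 1 + j) * periodicExt p η (l + 1 + j) (m % p ^ l) ω :=
    tsum_congr fun i => by rw [show i + l + 1 = l + 1 + i by ring]
  rw [ta] at ea
  rw [tb] at eb
  have ba := abs_le.1 (abs_tsum_le_of_tailSum_le hc hc1 hM h₁)
  have bb := abs_le.1 (abs_tsum_le_of_tailSum_le hc hc1 hM h₂)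
  have b1 := abs_le.1 (hB m)
  have b2 := abs_le.1 (hB (m % p ^ l))
  have habs : c ^ (l + 1) * |periodicExt p η (l + 1) m ω| =
      |c ^ (l + 1) * periodicExt p η (l + 1) m ω| := by
    rw [abs_mul, abs_of_nonneg (pow_nonneg hc _)]
  -- The entry equals `X_m - X_{m % p ^ l}` minus the tail of `m` plus the tail of `m % p ^ l`; the
  -- series at index `0` cancels.
  rw [habs, abs_le]
  constructor <;> linarith

/-! ### Large entries at leading indices, independent of small tails -/

section Necessity

variable {Ω Ω' : Type*} [MeasurableSpace Ω] [MeasurableSpace Ω'] {P : Measure Ω} {P' : Measure Ω'}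
  {p : ℕ} {η : ℕ → ℕ → Ω → ℝ} {Y : Ω' → ℝ} {c : ℝ}

/-- The node `m + 1` at the first level at which it is its own residue. -/
def leadingIndex (hp : 1 < p) (m : ℕ) : TreeIndex p :=
  ⟨(Nat.log p (m + 1) + 1, m + 1), by simp, Nat.lt_pow_succ_log_self hp (m + 1)⟩

theorem leadingIndex_injective (hp : 1 < p) : (leadingIndex hp).Injective := by
  intro i j h
  have := congrArg (fun x : TreeIndex p => x.1.2) h
  simpa [leadingIndex] using this

/-- The event that the entry at the leading index of `m + 1` is large. -/
def largeEntry (p : ℕ) (c : ℝ) (η : ℕ → ℕ → Ω → ℝ) (T : ℝ) (m : ℕ) : Set Ω :=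
  {ω | T < c ^ (Nat.log p (m + 1) + 1) * |η (Nat.log p (m + 1) + 1) (m + 1) ω|}

/-- The event that the tails of `m + 1`, and of its residue at the level before the leading index,
are small. -/
def smallTails (p : ℕ) (c : ℝ) (η : ℕ → ℕ → Ω → ℝ) (M : ENNReal) (m : ℕ) : Set Ω :=
  {ω | tailSum p c η (Nat.log p (m + 1) + 2) (m + 1) ω ≤ M ∧
    tailSum p c η (Nat.log p (m + 1) + 1) ((m + 1) % p ^ Nat.log p (m + 1)) ω ≤ M}

theorem measurableSet_largeEntry (hm : ∀ k n, Measurable (η k n)) (T : ℝ) (m : ℕ) :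
    MeasurableSet (largeEntry p c η T m) :=
  measurableSet_lt measurable_const (by fun_prop)

theorem measurableSet_smallTails (hm : ∀ k n, Measurable (η k n)) (M : ENNReal) (m : ℕ) :
    MeasurableSet (smallTails p c η M m) :=
  (measurableSet_le (measurable_tailSum hm _ _) measurable_const).inter
    (measurableSet_le (measurable_tailSum hm _ _) measurable_const)

theorem half_le_measure_smallTails [IsProbabilityMeasure P] (hm : ∀ k n, Measurable (η k n))
    {M : ENNReal} (hM : ∀ k n, 1 ≤ k → P {ω | M < tailSum p c η k n ω} ≤ 4⁻¹) (m : ℕ) :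
    2⁻¹ ≤ P (smallTails p c η M m) := by
  have h4 : (4⁻¹ : ENNReal) + 4⁻¹ = 2⁻¹ := by
    rw [show (4 : ENNReal) = 2 * 2 by norm_num, ENNReal.mul_inv (by simp) (by simp), ← mul_add,
      ENNReal.inv_two_add_inv_two, mul_one]
  have hcompl : P (smallTails p c η M m)ᶜ ≤ 2⁻¹ := by
    rw [← h4]
    refine le_trans (measure_mono fun ω hω => ?_) ((measure_union_le _ _).trans
      (add_le_add (hM (Nat.log p (m + 1) + 2) (m + 1) (by omega))
        (hM (Nat.log p (m + 1) + 1) ((m + 1) % p ^ Nat.log p (m + 1)) (by omega))))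
    simp only [smallTails, Set.mem_compl_iff, Set.mem_ofPred_eq, not_and_or, not_le] at hω
    exact hω
  have hadd := prob_add_prob_compl (μ := P) (measurableSet_smallTails (p := p) (c := c) hm M m)
  have h1 : 2⁻¹ + (2⁻¹ : ENNReal) ≤ P (smallTails p c η M m) + 2⁻¹ := by
    rw [ENNReal.inv_two_add_inv_two, ← hadd]
    gcongr
  exact (ENNReal.add_le_add_iff_right (by simp)).1 h1

/-- With `l = Nat.log p (m + 1)`, the tails read only levels above `l + 1` and, at level `l + 1`,
residues below `p ^ l`. Leading indices of `i + 1` with `i ≤ m` lie at levels at most `l + 1`, and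
at level `l + 1` they are at least `p ^ l`. The two sets of nodes are therefore disjoint. -/
theorem measure_disjointed_inter_smallTails (hp : 1 < p) (hη : IsIIDTriangularArray P P' p η Y)
    (hm : ∀ k n, Measurable (η k n)) (T : ℝ) (M : ENNReal) (m : ℕ) :
    P (disjointed (largeEntry p c η T) m ∩ smallTails p c η M m) =
      P (disjointed (largeEntry p c η T) m) * P (smallTails p c η M m) := by
  let f : TreeIndex p → Ω → ℝ := fun j => η j.1.1 j.1.2
  let U : Set (TreeIndex p) := {j | Nat.log p (m + 1) + 1 < j.1.1 ∨
    j.1.1 = Nat.log p (m + 1) + 1 ∧ j.1.2 < p ^ Nat.log p (m + 1)}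
  let S : Set (TreeIndex p) := Uᶜ
  have hind := indep_iSup_of_disjoint (m := fun j => MeasurableSpace.comap (f j) inferInstance)
    (fun j => (hm j.1.1 j.1.2).comap_le) hη.indep.iIndep (disjoint_compl_left : Disjoint S U)
  refine (Indep_iff _ _ _).1 hind _ _ ?_ ?_
  · refine @measurableSet_disjointed_of_forall_le _ (_) _ _ fun i hi => ?_
    have hmem : leadingIndex hp i ∈ S := by
      have hlog : Nat.log p (i + 1) ≤ Nat.log p (m + 1) := Nat.log_mono_right (by omega)
      have hpow : p ^ Nat.log p (i + 1) ≤ i + 1 := Nat.pow_log_le_self p (by omega)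
      simp only [S, U, leadingIndex, Set.mem_compl_iff, Set.mem_ofPred_eq, not_or, not_and, not_lt]
      refine ⟨by omega, fun h => ?_⟩
      rwa [← Nat.add_right_cancel h]
    have hset : MeasurableSet {x : ℝ | T < c ^ (Nat.log p (i + 1) + 1) * |x|} :=
      measurableSet_lt measurable_const (by fun_prop)
    exact (measurable_iSup_comap f hmem) hset
  · have htail : ∀ k n, (∀ j, ∀ h : 1 ≤ k + j ∧ n % p ^ (k + j) < p ^ (k + j),
        (⟨(k + j, n % p ^ (k + j)), h⟩ : TreeIndex p) ∈ U) → 1 ≤ k →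
        Measurable[⨆ j ∈ U, MeasurableSpace.comap (f j) inferInstance] (tailSum p c η k n) := by
      intro k n h hk
      refine @Measurable.tsum _ _ _ (_) _ _ _ _ _ _ _ _ _ _ _ _ fun j => ?_
      have hj : 1 ≤ k + j ∧ n % p ^ (k + j) < p ^ (k + j) :=
        ⟨by omega, Nat.mod_lt _ (pow_pos (by omega) _)⟩
      have hg : Measurable fun x : ℝ => ENNReal.ofReal (c ^ j * |x|) := by fun_prop
      exact hg.comp (measurable_iSup_comap f (h j hj))
    have hset : MeasurableSet (Set.Iic M) := measurableSet_Iic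
    refine @MeasurableSet.inter _ (_) _ _ (htail _ _ (fun j hj => Or.inl ?_) (by omega) hset)
      (htail _ _ (fun j hj => ?_) (by omega) hset)
    · simp only
      omega
    · rcases Nat.eq_zero_or_pos j with rfl | hj0
      · refine Or.inr ⟨rfl, ?_⟩
        exact (Nat.mod_le _ _).trans_lt (Nat.mod_lt _ (pow_pos (by omega) _))
      · refine Or.inl ?_
        simp only
        omega

theorem iIndepSet_largeEntry (hp : 1 < p) (hη : IsIIDTriangularArray P P' p η Y)
    (hm : ∀ k n, Measurable (η k n)) (T : ℝ) : iIndepSet (largeEntry p c η T) P := by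
  rw [iIndepSet_iff_meas_biInter (measurableSet_largeEntry hm T)]
  intro s
  have hset : ∀ i, MeasurableSet {x : ℝ | T < c ^ (Nat.log p (i + 1) + 1) * |x|} :=
    fun i => measurableSet_lt measurable_const (by fun_prop)
  exact (hη.indep.precomp (leadingIndex_injective hp)).meas_biInter
    fun i _ => ⟨_, hset i, rfl⟩

/-- Since `p ^ l ≤ m + 1` and `(c ^ (l + 1)) ^ q = p ^ (-(l + 1))`, the event `m + 1 < |Y| ^ q / (p
* T ^ q)` forces `T < c ^ (l + 1) * |Y|`. The series thus dominates the layer-cake sum of a variable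
of infinite mean. -/
theorem tsum_measure_largeEntry [IsFiniteMeasure P'] (hp : 1 < p)
    (hη : IsIIDTriangularArray P P' p η Y) (hc : 0 < c) {q : ℝ} (hq : 0 < q) (hpc : p * c ^ q = 1)
    (hY : ∫⁻ ω, ENNReal.ofReal (|Y ω| ^ q) ∂P' = ⊤) {T : ℝ} (hT : 0 < T) :
    ∑' m, P (largeEntry p c η T m) = ⊤ := by
  have hYm : AEMeasurable Y P' := (hη.identDistrib 1 0 le_rfl (by simp; omega)).aemeasurable_snd
  have hp0 : (0 : ℝ) < p := by exact_mod_cast (by omega : 0 < p)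
  have hTq : 0 < T ^ q := Real.rpow_pos_of_pos hT q
  have hgm : Measurable fun x : ℝ => (p * T ^ q)⁻¹ * |x| ^ q := by fun_prop
  have htop : ∫⁻ ω, ENNReal.ofReal ((p * T ^ q)⁻¹ * |Y ω| ^ q) ∂P' = ⊤ := by
    simp only [ENNReal.ofReal_mul (show 0 ≤ (p * T ^ q)⁻¹ by positivity)]
    rw [lintegral_const_mul' _ _ ENNReal.ofReal_ne_top, hY, ENNReal.mul_top]
    simpa using by positivity
  rw [eq_top_iff, ← tsum_measure_add_one_lt_eq_top (hgm.comp_aemeasurable hYm) htop]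
  refine ENNReal.tsum_le_tsum fun m => ?_
  set l := Nat.log p (m + 1) with hl
  have hset : MeasurableSet {x : ℝ | T < c ^ (l + 1) * |x|} :=
    measurableSet_lt measurable_const (by fun_prop)
  have hlaw := (hη.identDistrib (l + 1) (m + 1) (by omega)
    (Nat.lt_pow_succ_log_self hp (m + 1))).measure_mem_eq hset
  refine le_trans (measure_mono fun ω hω => ?_) hlaw.ge
  change (m : ℝ) + 1 < (p * T ^ q)⁻¹ * |Y ω| ^ q at hω
  change T < c ^ (l + 1) * |Y ω|
  have hpow : (p : ℝ) ^ l ≤ m + 1 := by exact_mod_cast Nat.pow_log_le_self p (by omega : m + 1 ≠ 0)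
  have h1 : (p : ℝ) ^ (l + 1) * T ^ q < |Y ω| ^ q := by
    have h2 : (p : ℝ) ^ l < (p * T ^ q)⁻¹ * |Y ω| ^ q := hpow.trans_lt hω
    rw [inv_mul_eq_div, lt_div_iff₀ (by positivity)] at h2
    calc (p : ℝ) ^ (l + 1) * T ^ q = p ^ l * (p * T ^ q) := by ring
      _ < _ := h2
  have h3 : (c ^ (l + 1)) ^ q = ((p : ℝ) ^ (l + 1))⁻¹ := by
    rw [← Real.rpow_natCast, ← Real.rpow_mul hc.le, mul_comm, Real.rpow_mul hc.le, Real.rpow_natCast,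
      eq_inv_of_mul_eq_one_right hpc, inv_pow]
  have h4 : T ^ q < (c ^ (l + 1) * |Y ω|) ^ q := by
    rw [Real.mul_rpow (by positivity) (abs_nonneg _), h3, inv_mul_eq_div, lt_div_iff₀ (by positivity),
      mul_comm]
    exact h1
  exact (Real.rpow_lt_rpow_iff hT.le (by positivity) hq).1 h4

/-- If `p * c ^ q = 1`, bounded sample paths force `E[|Y| ^ q]` to be finite. -/
theorem lintegral_ne_top_of_hasBoundedSamplePaths [IsProbabilityMeasure P] [IsFiniteMeasure P']
    (hp : 1 < p) (hη : IsIIDTriangularArray P P' p η Y) (hm : ∀ k n, Measurable (η k n))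
    (hc : 0 < c) (hc1 : c < 1) {q : ℝ} (hq : 0 < q) (hpc : p * c ^ q = 1)
    (hs : ∀ᵐ ω ∂P, ∀ n, Summable fun k => c ^ (k + 1) * |periodicExt p η (k + 1) n ω|)
    {M : ENNReal} (hMtop : M ≠ ⊤) (hM : ∀ k n, 1 ≤ k → P {ω | M < tailSum p c η k n ω} ≤ 4⁻¹)
    (hX : HasBoundedSamplePaths P (process p c η)) :
    ∫⁻ ω, ENNReal.ofReal (|Y ω| ^ q) ∂P' ≠ ⊤ := by
  intro hY
  let E : ℕ → Set Ω := fun N => ⋃ m, largeEntry p c η ((N : ℝ) + 1) m ∩ smallTails p c η M m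
  have hE : ∀ N, 2⁻¹ ≤ P (E N) := by
    intro N
    -- Second Borel–Cantelli lemma; only the consequence that almost surely some entry is large is
    -- used.
    have hlim := measure_limsup_eq_one (measurableSet_largeEntry hm _)
      (iIndepSet_largeEntry (c := c) hp hη hm ((N : ℝ) + 1))
      (tsum_measure_largeEntry hp hη hc hq hpc hY (by positivity))
    refine half_le_measure_iUnion_inter (measurableSet_largeEntry hm _)
      (measurableSet_smallTails hm M)
      (measure_disjointed_inter_smallTails hp hη hm _ M) (half_le_measure_smallTails hm hM) ?_
    refine le_antisymm prob_le_one (hlim.ge.trans (measure_mono ?_))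
    rw [Filter.limsup_eq_iInf_iSup_of_nat]
    refine (iInf_le _ 0).trans ?_
    simp
  have hanti : Antitone E := by
    intro N N' hN
    refine Set.iUnion_mono fun m => Set.inter_subset_inter_left _ fun ω hω => ?_
    refine lt_of_le_of_lt ?_ (Set.mem_ofPred.1 hω)
    gcongr
  have hEm : ∀ N, MeasurableSet (E N) := fun N => MeasurableSet.iUnion fun m =>
    (measurableSet_largeEntry hm _ m).inter (measurableSet_smallTails hm M m)
  -- Continuity from above yields one event of probability at least `1 / 2` on which every threshold
  -- is exceeded, whereas a bounded path excludes all large `N`.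
  have hinter : 2⁻¹ ≤ P (⋂ N, E N) := by
    rw [hanti.measure_iInter (fun N => (hEm N).nullMeasurableSet) ⟨0, measure_ne_top _ _⟩]
    exact le_iInf hE
  have hnull : P (⋂ N, E N) = 0 := by
    rw [measure_eq_zero_iff_ae_notMem]
    filter_upwards [hs, hX] with ω hsω ⟨B, hB⟩ hω
    obtain ⟨N, hN⟩ := exists_nat_ge (2 * B + 2 * M.toReal)
    obtain ⟨m, hlarge, hsmall⟩ := Set.mem_iUnion.1 (Set.mem_iInter.1 hω N)
    have hle := abs_entry_le hc.le hc1.le hsω (fun n => hB ⟨n, rfl⟩) hMtop hsmall.1 hsmall.2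
    rw [periodicExt, Nat.mod_eq_of_lt (Nat.lt_pow_succ_log_self hp (m + 1))] at hle
    have hlt : (N : ℝ) + 1 < _ := hlarge
    linarith
  rw [hnull] at hinter
  simp at hinter

end Necessity

/-! ### Reduction to measurable entries and conclusion -/

theorem summable_and_hasBoundedSamplePaths_iff {Ω Ω' : Type*} [MeasurableSpace Ω] [MeasurableSpace Ω']
    (P : Measure Ω) [IsProbabilityMeasure P] (P' : Measure Ω') [IsProbabilityMeasure P']
    (p : ℕ) (hp : p.Prime) (c : ℝ) (hc0 : 0 < c) (hc1 : c < 1)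
    (Y : Ω' → ℝ) (η : ℕ → ℕ → Ω → ℝ)
    (hη : IsIIDTriangularArray P P' p η Y)
    (hY : ∃ α : ℝ, 0 < α ∧ Integrable (fun ω => |Y ω| ^ α) P') :
    (∀ᵐ ω ∂P, ∀ n : ℕ, Summable fun k : ℕ => term p c η n (k + 1) ω) ∧
    (HasBoundedSamplePaths P (process p c η) ↔
      Integrable (fun ω => |Y ω| ^ (-(Real.log p / Real.log c))) P') := by
  have : NeZero p := ⟨hp.ne_zero⟩
  have hYm : AEMeasurable Y P' :=
    (hη.identDistrib 1 0 le_rfl (by simpa using hp.pos)).aemeasurable_snd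
  have hlogc : Real.log c < 0 := Real.log_neg hc0 hc1
  have hlogp : 0 < Real.log p := Real.log_pos (by exact_mod_cast hp.one_lt)
  set q : ℝ := -(Real.log p / Real.log c) with hq
  have hq0 : 0 < q := neg_pos.2 (div_neg_of_pos_of_neg hlogp hlogc)
  have hpc : (p : ℝ) * c ^ q = 1 := by
    have hp0 : (0 : ℝ) < p := by exact_mod_cast hp.pos
    rw [Real.rpow_def_of_pos hc0, hq, show Real.log c * -(Real.log p / Real.log c) = -Real.log p by
      rw [mul_neg, mul_div_cancel₀ _ hlogc.ne], Real.exp_neg, Real.exp_log hp0, mul_inv_cancel₀ hp0.ne']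
  obtain ⟨β, hβ, hYβ⟩ := hY
  -- The exponent is lowered to at most `1` to make the power subadditive in the tail estimates.
  have hα : 0 < min β 1 := lt_min hβ one_pos
  have hα1 : min β 1 ≤ 1 := min_le_right _ _
  have hYα : ∫⁻ ω, ENNReal.ofReal (|Y ω| ^ min β 1) ∂P' ≠ ⊤ :=
    lintegral_abs_rpow_ne_top_of_le hα.le (min_le_left _ _)
      ((integrable_abs_rpow_iff hYm β).1 hYβ)
  -- Replace the entries of the array by measurable versions.
  have hmk : ∀ j : TreeIndex p, AEMeasurable (η j.1.1 j.1.2) P :=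
    fun j => (hη.identDistrib _ _ j.2.1 j.2.2).aemeasurable_fst
  let ζ : ℕ → ℕ → Ω → ℝ := fun k n =>
    if h : 1 ≤ k ∧ n < p ^ k then (hmk ⟨(k, n), h⟩).mk else 0
  have hζm : ∀ k n, Measurable (ζ k n) := by
    intro k n
    simp only [ζ]
    split_ifs with h
    · exact (hmk ⟨(k, n), h⟩).measurable_mk
    · exact measurable_zero
  have hζη : ∀ j : TreeIndex p, η j.1.1 j.1.2 =ᵐ[P] ζ j.1.1 j.1.2 := by
    intro j
    simp only [ζ, dif_pos j.2]
    exact (hmk j).ae_eq_mk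
  have hζ : IsIIDTriangularArray P P' p ζ Y :=
    ⟨hη.indep.congr hζη, fun k n hk hn => (IdentDistrib.of_ae_eq (hζm k n).aemeasurable
      (hζη ⟨(k, n), hk, hn⟩).symm).trans (hη.identDistrib k n hk hn)⟩
  have hae : ∀ᵐ ω ∂P, ∀ n k, term p c η n (k + 1) ω = term p c ζ n (k + 1) ω := by
    filter_upwards [ae_all_iff.2 hζη] with ω hω n k
    have hval : ∀ n, periodicExt p η (k + 1) n ω = periodicExt p ζ (k + 1) n ω := fun n =>
      hω ⟨(k + 1, n % p ^ (k + 1)), by simp, Nat.mod_lt _ (pow_pos hp.pos _)⟩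
    rw [term, term, hval, hval]
  have hs := ae_summable_abs hζ hζm hc0.le hc1 hα hα1 hYα
  have hbdd : HasBoundedSamplePaths P (process p c η) ↔ HasBoundedSamplePaths P (process p c ζ) := by
    refine Filter.eventually_congr ?_
    filter_upwards [hae] with ω hω
    simp only [process, hω]
  refine ⟨?_, ?_⟩
  · filter_upwards [hs, hae] with ω hsω hω n
    simp only [hω]
    exact ((summable_term hc0.le hsω n).sub (summable_term hc0.le hsω 0)).congr
      fun k => (mul_sub _ _ _).symm
  · rw [hbdd, integrable_abs_rpow_iff hYm]
    obtain ⟨M, hMtop, hM⟩ := exists_measure_tailSum_le hζ hζm hc0.le hc1 hα hα1 hYα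
    exact ⟨lintegral_ne_top_of_hasBoundedSamplePaths hp.one_lt hζ hζm hc0 hc1 hq0 hpc hs hMtop hM,
      hasBoundedSamplePaths_of_lintegral_ne_top hζ hζm hc0 hc1 hq0 hpc hs⟩

end PadicSssi

theorem mainTheorem4 {Ω Ω' : Type*} [MeasurableSpace Ω] [MeasurableSpace Ω']
    (P : Measure Ω) [IsProbabilityMeasure P] (P' : Measure Ω') [IsProbabilityMeasure P']
    (p : ℕ) (hp : p.Prime) (c : ℝ) (hc0 : 0 < c) (hc1 : c < 1)
    (Y : Ω' → ℝ) (η : ℕ → ℕ → Ω → ℝ)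
    (hη : PadicSssi.IsIIDTriangularArray P P' p η Y)
    (hY : ∃ α : ℝ, 0 < α ∧ Integrable (fun ω => |Y ω| ^ α) P') :
    (∀ᵐ ω ∂P, ∀ n : ℕ, Summable fun k : ℕ => PadicSssi.term p c η n (k + 1) ω) ∧
    (PadicSssi.HasBoundedSamplePaths P (PadicSssi.process p c η) ↔
      Integrable (fun ω => |Y ω| ^ (-(Real.log p / Real.log c))) P') :=
  PadicSssi.summable_and_hasBoundedSamplePaths_iff P P' p hp c hc0 hc1 Y η hη hY
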